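/- All alphabets are finite, logarithms are natural, and a conditional law $P_{B|A}$ is a stochastic matrix. Given alphabets $\mathcal S,\mathcal X,\mathcal Y,\widehat{\mathcal S}$, a source law $P_S$, a channel $P_{Y|X}$ and a loss $\kappa:\mathcal S\times\mathcal X\times\mathcal Y\times\widehat{\mathcal S}\to\mathbb R$, let $$\mathrm{OPT}(\mathrm{SC})=\inf\ \sum_{s,x,y,\hat s}\kappa(s,x,y,\hat s)\,P_S(s)Q_{X|S}(x|s)P_{Y|X}(y|x)Q_{\widehat S|Y}(\hat s|y),$$ the infimum being over all codes, i.e. pairs of a (possibly randomized) encoder $Q_{X|S}$ and decoder $Q_{\widehat S|Y}$. Let $\mathrm{OPT}(\mathrm{DP})$ be the supremum of $$\sum_s\gamma^a(s)+\sum_y\gamma^b(y)-\sum_{s,x,y,\hat s}\mu(s,x,y,\hat s)$$ over all real functions $\gamma^a(s),\gamma^b(y),\lambda^a(s,\hat s,y),\lambda^b(x,s,y)$ and $\mu(s,x,y,\hat s)\ge 0$ such that, for all $s,x,y,\hat s$, $$\gamma^a(s)-\sum_{y}\lambda^b(x,s,y)-\sum_{\hat s,y}\mu(s,x,y,\hat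 s)\le 0,\qquad \gamma^b(y)-\sum_{s}\lambda^a(s,\hat s,y)-\sum_{x,s}\mu(s,x,y,\hat s)\le 0,$$ $$\lambda^a(s,\hat s,y)+\lambda^b(x,s,y)+\mu(s,x,y,\hat s)\le\kappa(s,x,y,\hat s)P_S(s)P_{Y|X}(y|x).$$ For a probability distribution $P_{\bar Y}$ on $\mathcal Y$ let $i_{X;\bar Y}(x;y)=\log\frac{P_{Y|X}(y|x)}{P_{\bar Y}(y)}\in[-\infty,\infty]$, with value $-\infty$ if $P_{Y|X}(y|x)=0$ and $+\infty$ if $P_{Y|X}(y|x)>0=P_{\bar Y}(y)$. **Corollary (DP improves on Wolfowitz's converse).** Let $M\ge 1$, $\mathcal S=\widehat{\mathcal S}=\{1,\dots,M\}$, $P_S(s)=1/M$, $\kappa(s,x,y,\hat s)=\mathbb I\{s\ne\hat s\}$, and let $P_{Y|X}$ be a channel with $\mathcal X\neq\emptyset$. Then, for every code, deterministic or randomized, $$\mathbb P[S\ne\widehat S]\ \ge\ \mathrm{OPT}(\mathrm{SC})\ \ge\ \mathrm{OPT}(\mathrm{DP})\ \ge\ B(P_{Y|X},M),$$ where $$B(P_{Y|X},M)=\sup_{\gamma\in\mathbb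 R}\sup_{P_{\bar Y}}\Big\{\inf_x\Big[\mathbb P[i_{X;\bar Y}(x;Y)\le\log M-\gamma]+Me^{-\gamma}\sum_{y}P_{\bar Y}(y)\,\mathbb I\{i_{X;\bar Y}(x;y)>\log M-\gamma\}\Big]-e^{-\gamma}\Big\},$$ $\mathbb P$ inside the braces being with respect to $Y\sim P_{Y|X=x}$. This bound is at least as large as Wolfowitz's bound: $$B(P_{Y|X},M)\ \ge\ \sup_{\gamma>0}\sup_{P_{\bar Y}}\Big\{\inf_x\mathbb P[i_{X;\bar Y}(x;Y)\le\log M-\gamma]-e^{-\gamma}\Big\}.$$ Further, let $V$ be a channel from a nonempty finite alphabet $\mathcal A$ to a finite alphabet $\mathcal B$, let $C=\sup_{P_X}I(X;Y)$ be its capacity in nats, and let $R>C$. For each $n$ let $P^{(n)}(y|x)=\prod_{i=1}^nV(y_i|x_i)$ be the stationary memoryless channel from $\mathcal A^n$ to $\mathcal B^n$, and let $M_n$ be integers with $M_n\ge\lfloor e^{nR}\rfloor$ for all large $n$ (in particular $M_n=e^{nR}$ when this is an integer, or $e^{nR}$ rounded up or down). Then, as $n\to\infty$, $B(P^{(n)},M_n)$,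 and hence also $\mathrm{OPT}(\mathrm{DP})$ and $\mathrm{OPT}(\mathrm{SC})$ for $M_n$ messages over $P^{(n)}$, tend to $1$. -/

import Mathlib

open Filter Topology

namespace JSCC

noncomputable section

/-- A channel (stochastic kernel) between finite alphabets: every row is a probability vector. -/
def IsChannel {A B : Type*} [Fintype B] (W : A → B → ℝ) : Prop :=
  ∀ a, W a ∈ stdSimplex ℝ B

section General

variable {S X Y T : Type*} [Fintype S] [Fintype X] [Fintype Y] [Fintype T]

/-- Expected loss `E[κ(S, X, Y, Ŝ)]` of the randomized code with encoder `E = Q_{X|S}` and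
decoder `D = Q_{Ŝ|Y}`, for the source law `P` and the channel `W = P_{Y|X}`. -/
def expectedLoss (κ : S → X → Y → T → ℝ) (P : S → ℝ) (W : X → Y → ℝ)
    (E : S → X → ℝ) (D : Y → T → ℝ) : ℝ :=
  ∑ s, ∑ x, ∑ y, ∑ t, κ s x y t * (P s * E s x * W x y * D y t)

/-- `OPT(SC)`: the least expected loss over all (randomized) codes. -/
def optSC (κ : S → X → Y → T → ℝ) (P : S → ℝ) (W : X → Y → ℝ) : EReal :=
  ⨅ (E : S → X → ℝ) (_ : IsChannel E) (D : Y → T → ℝ) (_ : IsChannel D),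
    ((expectedLoss κ P W E D : ℝ) : EReal)

/-- The variables of the dual program `DP`. -/
structure DualVars (S X Y T : Type*) where
  gammaA : S → ℝ
  gammaB : Y → ℝ
  lambdaA : S → T → Y → ℝ
  lambdaB : X → S → Y → ℝ
  mu : S → X → Y → T → ℝ

/-- The objective of the dual program `DP`. -/
def DualVars.objective (v : DualVars S X Y T) : ℝ :=
  ∑ s, v.gammaA s + ∑ y, v.gammaB y - ∑ s, ∑ x, ∑ y, ∑ t, v.mu s x y t

/-- The constraints of the dual program `DP`. -/
structure DualVars.Feasible (κ : S → X → Y → T → ℝ) (P : S → ℝ) (W : X → Y → ℝ)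
    (v : DualVars S X Y T) : Prop where
  d1 : ∀ x s, v.gammaA s - ∑ y, v.lambdaB x s y - ∑ t, ∑ y, v.mu s x y t ≤ 0
  d2 : ∀ t y, v.gammaB y - ∑ s, v.lambdaA s t y - ∑ x, ∑ s, v.mu s x y t ≤ 0
  d3 : ∀ s x y t, v.lambdaA s t y + v.lambdaB x s y + v.mu s x y t ≤ κ s x y t * P s * W x y
  mu_nonneg : ∀ s x y t, 0 ≤ v.mu s x y t

/-- `OPT(DP)`: the supremum of the dual objective over the dual feasible points. -/
def optDP (κ : S → X → Y → T → ℝ) (P : S → ℝ) (W : X → Y → ℝ) : EReal :=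
  ⨆ (v : DualVars S X Y T) (_ : v.Feasible κ P W), ((v.objective : ℝ) : EReal)

end General

/-! Channel coding with `M` equiprobable messages. -/

/-- The error loss `𝟙{s ≠ ŝ}`. -/
def errorLoss (M : ℕ) (X Y : Type*) : Fin M → X → Y → Fin M → ℝ :=
  fun s _ _ t => if s ≠ t then 1 else 0

/-- The uniform law on `M` messages. -/
def uniformSource (M : ℕ) : Fin M → ℝ := fun _ => 1 / (M : ℝ)

/-- Error probability `P[S ≠ Ŝ]` of the deterministic code `(f, g)`, `S` uniform. -/
def detError {X Y : Type*} [Fintype Y] {M : ℕ} (W : X → Y → ℝ) (f : Fin M → X) (g : Y → Fin M) :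
    ℝ :=
  ∑ s, (1 / (M : ℝ)) * ∑ y, if g y ≠ s then W (f s) y else 0

section Bounds

variable {X Y : Type*} [Fintype Y]

/-- The information density `log (P_{Y|X}(y|x) / Q(y))`, extended-real valued:
it is `-∞` if `P_{Y|X}(y|x) = 0`, and `+∞` if `P_{Y|X}(y|x) > 0 = Q(y)`. -/
def infoDensity (W : X → Y → ℝ) (Q : Y → ℝ) (x : X) (y : Y) : EReal :=
  ENNReal.log (ENNReal.ofReal (W x y) / ENNReal.ofReal (Q y))

/-- `P[i(x; Y) ≤ c]` with `Y` distributed according to `P_{Y|X=x}`. -/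
def probInfoLe (W : X → Y → ℝ) (Q : Y → ℝ) (x : X) (c : ℝ) : ℝ :=
  ∑ y, W x y * (if infoDensity W Q x y ≤ (c : EReal) then 1 else 0)

/-- `∑_y Q(y) 𝟙{i(x; y) > c}`. -/
def massInfoGt (W : X → Y → ℝ) (Q : Y → ℝ) (x : X) (c : ℝ) : ℝ :=
  ∑ y, Q y * (if (c : EReal) < infoDensity W Q x y then 1 else 0)

/-- The improved lower bound on the error probability. -/
def improvedBound (W : X → Y → ℝ) (M : ℕ) : EReal :=
  ⨆ (γ : ℝ) (Q : Y → ℝ) (_ : Q ∈ stdSimplex ℝ Y),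
    (((⨅ x, (probInfoLe W Q x (Real.log M - γ)
        + M * Real.exp (-γ) * massInfoGt W Q x (Real.log M - γ))) - Real.exp (-γ) : ℝ) : EReal)

/-- Wolfowitz's lower bound on the error probability. -/
def wolfowitzBound (W : X → Y → ℝ) (M : ℕ) : EReal :=
  ⨆ (γ : ℝ) (_ : 0 < γ) (Q : Y → ℝ) (_ : Q ∈ stdSimplex ℝ Y),
    (((⨅ x, probInfoLe W Q x (Real.log M - γ)) - Real.exp (-γ) : ℝ) : EReal)

end Bounds

section Memoryless

variable {A B : Type*} [Fintype A] [Fintype B]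

/-- The mutual information `I(X; Y)` (in nats) of the input law `P` and the channel `V`. -/
def mutualInfo (P : A → ℝ) (V : A → B → ℝ) : ℝ :=
  ∑ a, ∑ b, P a * V a b * Real.log (V a b / ∑ a', P a' * V a' b)

/-- The capacity (in nats) of the channel `V`. -/
def capacity (V : A → B → ℝ) : ℝ :=
  sSup ((fun P : A → ℝ => mutualInfo P V) '' stdSimplex ℝ A)

/-- The `n`-fold stationary memoryless channel with single-letter law `V`. -/
def memoryless (V : A → B → ℝ) (n : ℕ) : (Fin n → A) → (Fin n → B) → ℝ :=
  fun x y => ∏ i, V (x i) (y i)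

end Memoryless

end

end JSCC

/-! Weak duality: weighting the three dual constraints by the encoder, the decoder and their
product, and summing, bounds the dual objective by the loss of any code. Since M e^{-γ} Σ Q 𝟙{i >
log M - γ} replaces W by M e^{-γ} Q exactly where W is larger, the bracket in B is Σ_y min(W(y|x), M
e^{-γ} Q(y)), and an explicit dual point with `mu` = 0 attains it (`improvedBound_le_optDP`).
Dropping the nonnegative second term of the bracket leaves Wolfowitz's bound.

For the strong converse, take Q to be the output law of a capacity-achieving input. Optimality of
that input forces D(V_a ‖ Q) ≤ C for every letter a (`exists_relEntropy_le_capacity`). Hence, for c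
> C, a Chernoff bound on the sum of information densities under Q^n has a ratio ρ < 1 valid for all
input words (`exists_geometric_le_probInfoLe`). With γ growing linearly in n, B is at least 1 - ρ^n
- e^{-γ}, while OPT(SC) ≤ 1, so everything between is squeezed to 1. -/

namespace JSCC

/-! ### Weak duality for randomized codes -/

section WeakDuality

variable {S X Y T : Type*} [Fintype S] [Fintype X] [Fintype Y] [Fintype T]

theorem sum_sum_sum_sum_comm (F : S → X → Y → T → ℝ) :
    ∑ s, ∑ x, ∑ y, ∑ t, F s x y t = ∑ y, ∑ t, ∑ s, ∑ x, F s x y t := by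
  have h1 : ∑ s, ∑ x, ∑ y, ∑ t, F s x y t
      = ∑ p : S × X, ∑ q : Y × T, F p.1 p.2 q.1 q.2 := by
    simp only [Fintype.sum_prod_type]
  rw [h1, Finset.sum_comm]
  simp only [Fintype.sum_prod_type]

theorem DualVars.Feasible.sum_gammaA_le {κ : S → X → Y → T → ℝ} {P : S → ℝ} {W : X → Y → ℝ}
    {v : DualVars S X Y T} (hv : v.Feasible κ P W) {E : S → X → ℝ} {D : Y → T → ℝ}
    (hE : IsChannel E) (hD : IsChannel D) :
    ∑ s, v.gammaA s ≤
      ∑ s, ∑ x, ∑ y, ∑ t, (E s x * D y t * v.lambdaB x s y + E s x * v.mu s x y t) := by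
  refine Finset.sum_le_sum fun s _ => ?_
  have h1 : v.gammaA s = ∑ x, E s x * v.gammaA s := by
    rw [← Finset.sum_mul, (hE s).2, one_mul]
  rw [h1]
  refine Finset.sum_le_sum fun x _ => ?_
  have h2 : ∑ y, ∑ t, (E s x * D y t * v.lambdaB x s y + E s x * v.mu s x y t)
      = E s x * (∑ y, v.lambdaB x s y + ∑ t, ∑ y, v.mu s x y t) := by
    rw [Finset.sum_comm (s := (Finset.univ : Finset T)), ← Finset.sum_add_distrib, Finset.mul_sum]
    refine Finset.sum_congr rfl fun y _ => ?_
    rw [Finset.sum_add_distrib, ← Finset.sum_mul, ← Finset.mul_sum, (hD y).2, ← Finset.mul_sum]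
    ring
  rw [h2]
  exact mul_le_mul_of_nonneg_left (by linarith [hv.d1 x s]) ((hE s).1 x)

theorem DualVars.Feasible.sum_gammaB_le {κ : S → X → Y → T → ℝ} {P : S → ℝ} {W : X → Y → ℝ}
    {v : DualVars S X Y T} (hv : v.Feasible κ P W) {E : S → X → ℝ} {D : Y → T → ℝ}
    (hE : IsChannel E) (hD : IsChannel D) :
    ∑ y, v.gammaB y ≤
      ∑ s, ∑ x, ∑ y, ∑ t, (E s x * D y t * v.lambdaA s t y + D y t * v.mu s x y t) := by
  rw [sum_sum_sum_sum_comm]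
  refine Finset.sum_le_sum fun y _ => ?_
  have h1 : v.gammaB y = ∑ t, D y t * v.gammaB y := by
    rw [← Finset.sum_mul, (hD y).2, one_mul]
  rw [h1]
  refine Finset.sum_le_sum fun t _ => ?_
  have h2 : ∑ s, ∑ x, (E s x * D y t * v.lambdaA s t y + D y t * v.mu s x y t)
      = D y t * (∑ s, v.lambdaA s t y + ∑ x, ∑ s, v.mu s x y t) := by
    rw [Finset.sum_comm (s := (Finset.univ : Finset X)), ← Finset.sum_add_distrib, Finset.mul_sum]
    refine Finset.sum_congr rfl fun s _ => ?_
    rw [Finset.sum_add_distrib, ← Finset.sum_mul, ← Finset.sum_mul, (hE s).2, ← Finset.mul_sum]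
    ring
  rw [h2]
  exact mul_le_mul_of_nonneg_left (by linarith [hv.d2 t y]) ((hD y).1 t)

/-- Weak duality between `DP` and the code design problem. -/
theorem DualVars.Feasible.objective_le_expectedLoss {κ : S → X → Y → T → ℝ} {P : S → ℝ}
    {W : X → Y → ℝ} {v : DualVars S X Y T} (hv : v.Feasible κ P W) {E : S → X → ℝ}
    {D : Y → T → ℝ} (hE : IsChannel E) (hD : IsChannel D) :
    v.objective ≤ expectedLoss κ P W E D := by
  have hA := hv.sum_gammaA_le hE hD
  have hB := hv.sum_gammaB_le hE hD
  have hC : ∑ s, ∑ x, ∑ y, ∑ t, (E s x * D y t * v.lambdaB x s y + E s x * v.mu s x y t)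
      + ∑ s, ∑ x, ∑ y, ∑ t, (E s x * D y t * v.lambdaA s t y + D y t * v.mu s x y t)
      - ∑ s, ∑ x, ∑ y, ∑ t, v.mu s x y t ≤ expectedLoss κ P W E D := by
    unfold expectedLoss
    simp only [← Finset.sum_add_distrib, ← Finset.sum_sub_distrib]
    refine Finset.sum_le_sum fun s _ => Finset.sum_le_sum fun x _ => Finset.sum_le_sum fun y _ =>
      Finset.sum_le_sum fun t _ => ?_
    have hE1 : E s x ≤ 1 := (mem_Icc_of_mem_stdSimplex (hE s) x).2
    have hD1 : D y t ≤ 1 := (mem_Icc_of_mem_stdSimplex (hD y) t).2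
    have h1 := mul_le_mul_of_nonneg_left (hv.d3 s x y t) (mul_nonneg ((hE s).1 x) ((hD y).1 t))
    -- `mu` has weight E + D - 1 on the dual side but E D after weighting `d3`; the gap is (1 - E)(1
    -- - D) ≥ 0.
    have h2 := mul_nonneg (mul_nonneg (hv.mu_nonneg s x y t) (sub_nonneg.2 hE1))
      (sub_nonneg.2 hD1)
    linarith
  unfold DualVars.objective
  linarith

theorem optDP_le_optSC (κ : S → X → Y → T → ℝ) (P : S → ℝ) (W : X → Y → ℝ) :
    optDP κ P W ≤ optSC κ P W :=
  iSup₂_le fun _ hv => le_iInf₂ fun _ hE => le_iInf₂ fun _ hD =>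
    EReal.coe_le_coe_iff.2 (hv.objective_le_expectedLoss hE hD)

theorem optSC_le_expectedLoss {κ : S → X → Y → T → ℝ} {P : S → ℝ} {W : X → Y → ℝ}
    {E : S → X → ℝ} {D : Y → T → ℝ} (hE : IsChannel E) (hD : IsChannel D) :
    optSC κ P W ≤ ((expectedLoss κ P W E D : ℝ) : EReal) :=
  (iInf₂_le E hE).trans (iInf₂_le D hD)

end WeakDuality

/-! ### One-shot converse bounds -/

section Bounds

variable {X Y : Type*} [Fintype Y]

theorem optSC_le_detError [Fintype X] (W : X → Y → ℝ) {M : ℕ} (f : Fin M → X) (g : Y → Fin M) :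
    optSC (errorLoss M X Y) (uniformSource M) W ≤ ((detError W f g : ℝ) : EReal) := by
  classical
  have hE : IsChannel fun s => (Pi.single (f s) 1 : X → ℝ) :=
    fun s => single_mem_stdSimplex ℝ (f s)
  have hD : IsChannel fun y => (Pi.single (g y) 1 : Fin M → ℝ) :=
    fun y => single_mem_stdSimplex ℝ (g y)
  refine (optSC_le_expectedLoss hE hD).trans_eq ?_
  congr 1
  unfold expectedLoss detError errorLoss uniformSource
  refine Finset.sum_congr rfl fun s _ => ?_
  rw [Finset.sum_eq_single (f s) (fun x _ hx => by simp [Pi.single_eq_of_ne hx]) (by simp),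
    Finset.mul_sum]
  refine Finset.sum_congr rfl fun y _ => ?_
  rw [Finset.sum_eq_single (g y) (fun t _ ht => by simp [Pi.single_eq_of_ne ht]) (by simp)]
  simp only [Pi.single_eq_same, mul_one, ite_mul, one_mul, zero_mul, mul_ite, mul_zero, ne_comm]

theorem optSC_le_one [Fintype X] [Nonempty X] {W : X → Y → ℝ} (hW : IsChannel W) {M : ℕ} (hM : 1 ≤ M) :
    optSC (errorLoss M X Y) (uniformSource M) W ≤ 1 := by
  obtain ⟨x⟩ := ‹Nonempty X›
  refine (optSC_le_detError W (fun _ => x) (fun _ => ⟨0, hM⟩)).trans ?_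
  rw [← EReal.coe_one, EReal.coe_le_coe_iff]
  have hM' : (M : ℝ) ≠ 0 := by positivity
  calc detError W (fun _ => x) (fun _ => ⟨0, hM⟩)
      ≤ ∑ _s : Fin M, (1 / (M : ℝ)) * ∑ y, W x y := by
        refine Finset.sum_le_sum fun s _ => mul_le_mul_of_nonneg_left
          (Finset.sum_le_sum fun y _ => ?_) (by positivity)
        split_ifs
        exacts [le_rfl, (hW x).1 y]
    _ = 1 := by simp [(hW x).2, hM']

/-- The conventions at zero survive cross-multiplication: W = 0 gives density -∞ (even for 0/0) and
a true inequality, while W > 0 = Q gives +∞ and a false one. -/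
theorem infoDensity_le_coe_iff {X Y : Type*} {W : X → Y → ℝ} {Q : Y → ℝ} {x : X} {y : Y}
    (hQ : 0 ≤ Q y) (c : ℝ) :
    infoDensity W Q x y ≤ (c : EReal) ↔ W x y ≤ Real.exp c * Q y := by
  unfold infoDensity
  rw [← EReal.log_exp (c : EReal), ENNReal.log_le_log_iff, EReal.exp_coe,
    ENNReal.div_le_iff_le_mul (Or.inr ENNReal.ofReal_ne_top) (Or.inl ENNReal.ofReal_ne_top),
    ← ENNReal.ofReal_mul (Real.exp_pos c).le,
    ENNReal.ofReal_le_ofReal_iff (mul_nonneg (Real.exp_pos c).le hQ)]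

/-- The bracket of the improved bound is the total mass of `min (P_{Y|X=x}, M e^{-γ} Q)`. -/
theorem probInfoLe_add_massInfoGt {W : X → Y → ℝ} {Q : Y → ℝ} (hQ : ∀ y, 0 ≤ Q y) {M : ℕ}
    (hM : 1 ≤ M) (x : X) (γ : ℝ) :
    probInfoLe W Q x (Real.log M - γ)
        + M * Real.exp (-γ) * massInfoGt W Q x (Real.log M - γ)
      = ∑ y, min (W x y) (M * (Real.exp (-γ) * Q y)) := by
  have hexp : Real.exp (Real.log M - γ) = M * Real.exp (-γ) := by
    rw [sub_eq_add_neg, Real.exp_add, Real.exp_log (by exact_mod_cast hM)]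
  unfold probInfoLe massInfoGt
  rw [Finset.mul_sum, ← Finset.sum_add_distrib]
  refine Finset.sum_congr rfl fun y _ => ?_
  have h := infoDensity_le_coe_iff (W := W) (x := x) (hQ y) (Real.log M - γ)
  rw [hexp] at h
  by_cases hc : infoDensity W Q x y ≤ ((Real.log M - γ : ℝ) : EReal)
  · rw [if_pos hc, if_neg (not_lt.2 hc), min_eq_left (by linarith [h.1 hc])]
    ring
  · rw [if_neg hc, if_pos (not_le.1 hc), min_eq_right (by linarith [not_le.1 (mt h.2 hc)])]
    ring

theorem improvedBound_le_optDP [Fintype X] (W : X → Y → ℝ) {M : ℕ} (hM : 1 ≤ M) :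
    improvedBound W M ≤ optDP (errorLoss M X Y) (uniformSource M) W := by
  refine iSup_le fun γ => iSup₂_le fun Q hQ => ?_
  simp only [probInfoLe_add_massInfoGt hQ.1 hM]
  set m : ℝ := ⨅ x, ∑ y, min (W x y) (M * (Real.exp (-γ) * Q y)) with hm
  have hM0 : (0 : ℝ) < M := by exact_mod_cast hM
  -- For s = t the loss vanishes, so `lambdaB` may not exceed e^{-γ} Q = -`lambdaA`; for s ≠ t it
  -- may not exceed W / M. The minimum of the two is the largest choice, and `gammaA` is its
  -- smallest total over y.
  let v : DualVars (Fin M) X Y (Fin M) :=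
    { gammaA := fun _ => m / M
      gammaB := fun y => -(Real.exp (-γ) * Q y)
      lambdaA := fun s t y => if s = t then -(Real.exp (-γ) * Q y) else 0
      lambdaB := fun x _ y => min (W x y) (M * (Real.exp (-γ) * Q y)) / M
      mu := fun _ _ _ _ => 0 }
  have hv : v.Feasible (errorLoss M X Y) (uniformSource M) W := by
    refine ⟨fun x s => ?_, fun t y => ?_, fun s x y t => ?_, fun _ _ _ _ => le_rfl⟩
    · have : m ≤ ∑ y, min (W x y) (M * (Real.exp (-γ) * Q y)) :=
        ciInf_le (Set.finite_range _).bddBelow x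
      simp only [v, Finset.sum_const_zero, sub_zero, ← Finset.sum_div, sub_nonpos]
      gcongr
    · simp [v]
    · simp only [v, errorLoss, uniformSource, add_zero]
      by_cases hst : s = t
      · have : min (W x y) (M * (Real.exp (-γ) * Q y)) / M ≤ Real.exp (-γ) * Q y := by
          rw [div_le_iff₀ hM0, mul_comm _ (M : ℝ)]
          exact min_le_right _ _
        simp only [hst, if_true, ne_eq, not_true_eq_false, if_false, zero_mul]
        linarith
      · simp only [hst, if_false, ne_eq, not_false_eq_true, if_true, zero_add, one_mul]
        rw [one_div_mul_eq_div]
        gcongr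
        exact min_le_left _ _
  have hobj : v.objective = m - Real.exp (-γ) := by
    simp only [DualVars.objective, v, Finset.sum_const_zero, sub_zero, Finset.sum_neg_distrib,
      ← Finset.mul_sum, hQ.2, Finset.sum_const, Finset.card_univ, Fintype.card_fin, nsmul_eq_mul]
    field_simp
    ring
  rw [← hobj]
  exact le_iSup₂_of_le v hv le_rfl

theorem massInfoGt_nonneg (W : X → Y → ℝ) {Q : Y → ℝ} (hQ : ∀ y, 0 ≤ Q y) (x : X) (c : ℝ) :
    0 ≤ massInfoGt W Q x c :=
  Finset.sum_nonneg fun y _ => mul_nonneg (hQ y) (by split_ifs <;> norm_num)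

theorem iInf_probInfoLe_le_improvedBound [Finite X] [Nonempty X] (W : X → Y → ℝ) (M : ℕ) (γ : ℝ) {Q : Y → ℝ}
    (hQ : Q ∈ stdSimplex ℝ Y) :
    (((⨅ x, probInfoLe W Q x (Real.log M - γ)) - Real.exp (-γ) : ℝ) : EReal)
      ≤ improvedBound W M := by
  refine le_iSup_of_le γ (le_iSup₂_of_le Q hQ (EReal.coe_le_coe_iff.2 ?_))
  refine sub_le_sub_right (ciInf_mono (Set.finite_range _).bddBelow fun x => ?_) _
  have := massInfoGt_nonneg W hQ.1 x (Real.log M - γ)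
  have : 0 ≤ M * Real.exp (-γ) * massInfoGt W Q x (Real.log M - γ) := by positivity
  linarith

theorem wolfowitzBound_le_improvedBound [Finite X] [Nonempty X] (W : X → Y → ℝ) (M : ℕ) :
    wolfowitzBound W M ≤ improvedBound W M :=
  iSup₂_le fun γ _ => iSup₂_le fun _ hQ => iInf_probInfoLe_le_improvedBound W M γ hQ

end Bounds

/-! ### The capacity-achieving output law -/

section Capacity

variable {A B : Type*} [Fintype A] [Fintype B]

/-- The relative entropy (in nats) of probability vectors, for `p` absolutely continuous with
respect to `q`. -/
noncomputable def relEntropy (p q : B → ℝ) : ℝ := ∑ b, p b * Real.log (p b / q b)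

/-- The output law of the channel `V` with input law `P`. -/
noncomputable def outputLaw (P : A → ℝ) (V : A → B → ℝ) (b : B) : ℝ := ∑ a, P a * V a b

theorem relEntropy_nonneg {p q : B → ℝ} (hp : p ∈ stdSimplex ℝ B) (hq : q ∈ stdSimplex ℝ B)
    (hpq : ∀ b, q b = 0 → p b = 0) : 0 ≤ relEntropy p q := by
  have h : ∀ b, p b - q b ≤ p b * Real.log (p b / q b) := fun b => by
    rcases (hp.1 b).eq_or_lt with h0 | h0
    · rw [← h0]
      simpa using hq.1 b
    · have hqb : 0 < q b := (hq.1 b).lt_of_ne fun h => h0.ne' (hpq b h.symm)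
      have h1 := Real.one_sub_inv_le_log_of_pos (div_pos h0 hqb)
      have h2 := mul_le_mul_of_nonneg_left h1 h0.le
      have h3 : p b * (1 - (p b / q b)⁻¹) = p b - q b := by field_simp
      linarith
  have h2 := Finset.sum_le_sum fun b (_ : b ∈ Finset.univ) => h b
  rw [Finset.sum_sub_distrib, hp.2, hq.2, sub_self] at h2
  exact h2

theorem outputLaw_mem_stdSimplex {P : A → ℝ} {V : A → B → ℝ} (hP : P ∈ stdSimplex ℝ A)
    (hV : IsChannel V) : outputLaw P V ∈ stdSimplex ℝ B := by
  refine ⟨fun b => Finset.sum_nonneg fun a _ => mul_nonneg (hP.1 a) ((hV a).1 b), ?_⟩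
  unfold outputLaw
  rw [Finset.sum_comm]
  simp only [← Finset.mul_sum, (hV _).2, mul_one, hP.2]

theorem mul_le_outputLaw {P : A → ℝ} {V : A → B → ℝ} (hP : P ∈ stdSimplex ℝ A)
    (hV : IsChannel V) (a : A) (b : B) : P a * V a b ≤ outputLaw P V b :=
  Finset.single_le_sum (f := fun a => P a * V a b)
    (fun a _ => mul_nonneg (hP.1 a) ((hV a).1 b)) (Finset.mem_univ a)

/-- Compensation identity: replacing the true output law by q costs exactly their relative entropy.
-/
theorem sum_mul_relEntropy_eq {P : A → ℝ} {V : A → B → ℝ} {q : B → ℝ}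
    (hP : P ∈ stdSimplex ℝ A) (hV : IsChannel V) (hq : ∀ b, 0 ≤ q b)
    (hPq : ∀ b, q b = 0 → outputLaw P V b = 0) :
    ∑ a, P a * relEntropy (V a) q = mutualInfo P V + relEntropy (outputLaw P V) q := by
  have h : relEntropy (outputLaw P V) q
      = ∑ a, ∑ b, P a * V a b * Real.log (outputLaw P V b / q b) := by
    rw [Finset.sum_comm]
    simp only [← Finset.sum_mul]
    rfl
  rw [h, mutualInfo, ← Finset.sum_add_distrib]
  refine Finset.sum_congr rfl fun a _ => ?_
  rw [relEntropy, Finset.mul_sum, ← Finset.sum_add_distrib]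
  refine Finset.sum_congr rfl fun b _ => ?_
  change _ = P a * V a b * Real.log (V a b / outputLaw P V b) + _
  rcases (mul_nonneg (hP.1 a) ((hV a).1 b)).eq_or_lt with h0 | h0
  · rw [← mul_assoc, ← h0]
    simp
  · have hO : 0 < outputLaw P V b := h0.trans_le (mul_le_outputLaw hP hV a b)
    have hqb : 0 < q b := (hq b).lt_of_ne fun h => hO.ne' (hPq b h.symm)
    have hVab : 0 < V a b := pos_of_mul_pos_right h0 (hP.1 a)
    rw [Real.log_div hVab.ne' hqb.ne', Real.log_div hVab.ne' hO.ne', Real.log_div hO.ne' hqb.ne']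
    ring

theorem mutualInfo_eq_sum_mul_relEntropy (P : A → ℝ) (V : A → B → ℝ) :
    mutualInfo P V = ∑ a, P a * relEntropy (V a) (outputLaw P V) := by
  unfold mutualInfo relEntropy outputLaw
  simp only [Finset.mul_sum, mul_assoc]

/-- The form H(Y) - H(Y|X) is visibly continuous in P, also where output masses vanish. -/
theorem mutualInfo_eq_negMulLog {P : A → ℝ} {V : A → B → ℝ} (hP : P ∈ stdSimplex ℝ A)
    (hV : IsChannel V) :
    mutualInfo P V = ∑ b, Real.negMulLog (outputLaw P V b)
      - ∑ a, P a * ∑ b, Real.negMulLog (V a b) := by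
  have h : ∑ b, Real.negMulLog (outputLaw P V b)
      = ∑ a, ∑ b, -(P a * V a b * Real.log (outputLaw P V b)) := by
    rw [Finset.sum_comm]
    refine Finset.sum_congr rfl fun b _ => ?_
    rw [Finset.sum_neg_distrib, ← Finset.sum_mul]
    simp [Real.negMulLog, outputLaw]
  rw [h, ← Finset.sum_sub_distrib, mutualInfo]
  refine Finset.sum_congr rfl fun a _ => ?_
  rw [Finset.mul_sum, ← Finset.sum_sub_distrib]
  refine Finset.sum_congr rfl fun b _ => ?_
  change P a * V a b * Real.log (V a b / outputLaw P V b) = _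
  rcases (mul_nonneg (hP.1 a) ((hV a).1 b)).eq_or_lt with h0 | h0
  · rw [Real.negMulLog, neg_mul, mul_neg, ← mul_assoc, ← h0]
    simp
  · have hO : 0 < outputLaw P V b := h0.trans_le (mul_le_outputLaw hP hV a b)
    have hVab : 0 < V a b := pos_of_mul_pos_right h0 (hP.1 a)
    rw [Real.log_div hVab.ne' hO.ne', Real.negMulLog]
    ring

theorem continuousOn_mutualInfo {V : A → B → ℝ} (hV : IsChannel V) :
    ContinuousOn (fun P => mutualInfo P V) (stdSimplex ℝ A) := by
  have h : Continuous fun P : A → ℝ => ∑ b, Real.negMulLog (outputLaw P V b)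
      - ∑ a, P a * ∑ b, Real.negMulLog (V a b) := by
    unfold outputLaw
    fun_prop
  exact h.continuousOn.congr fun P hP => mutualInfo_eq_negMulLog hP hV

theorem exists_mutualInfo_eq_capacity [Nonempty A] {V : A → B → ℝ} (hV : IsChannel V) :
    ∃ P ∈ stdSimplex ℝ A, mutualInfo P V = capacity V ∧
      ∀ P' ∈ stdSimplex ℝ A, mutualInfo P' V ≤ capacity V := by
  classical
  have hne : (stdSimplex ℝ A).Nonempty :=
    ⟨_, single_mem_stdSimplex ℝ (Classical.arbitrary A)⟩
  obtain ⟨P, hP, hmax⟩ :=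
    (isCompact_stdSimplex ℝ A).exists_isMaxOn hne (continuousOn_mutualInfo hV)
  have hg : IsGreatest ((fun P : A → ℝ => mutualInfo P V) '' stdSimplex ℝ A)
      (mutualInfo P V) :=
    ⟨⟨P, hP, rfl⟩, by rintro _ ⟨P', hP', rfl⟩; exact hmax hP'⟩
  have hc : capacity V = mutualInfo P V := hg.csSup_eq
  exact ⟨P, hP, hc.symm, fun P' hP' => hc ▸ hmax hP'⟩

/-- Move the optimal input a fraction r towards the letter a. The new mutual information is at most
C and averages relative entropies to the new output law; by the compensation identity the part from
P averages at least C, so the part from a is at most C. No derivative is needed. -/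
theorem relEntropy_mix_le_capacity {V : A → B → ℝ} (hV : IsChannel V) {P : A → ℝ}
    (hP : P ∈ stdSimplex ℝ A) (hPC : mutualInfo P V = capacity V)
    (hmax : ∀ P' ∈ stdSimplex ℝ A, mutualInfo P' V ≤ capacity V) (a : A) {r : ℝ}
    (hr0 : 0 < r) (hr1 : r < 1) :
    relEntropy (V a) (fun b => (1 - r) * outputLaw P V b + r * V a b) ≤ capacity V := by
  classical
  have hr1' : 0 < 1 - r := sub_pos.2 hr1
  set P' : A → ℝ := (1 - r) • P + r • Pi.single a 1 with hP'def
  have hP' : P' ∈ stdSimplex ℝ A :=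
    convex_stdSimplex ℝ A hP (single_mem_stdSimplex ℝ a) hr1'.le hr0.le (by ring)
  have hout : outputLaw P' V = fun b => (1 - r) * outputLaw P V b + r * V a b := by
    funext b
    simp only [outputLaw, hP'def, Pi.add_apply, Pi.smul_apply, smul_eq_mul, add_mul,
      Finset.sum_add_distrib, mul_assoc, ← Finset.mul_sum]
    congr 2
    rw [Finset.sum_eq_single a (fun x _ hx => by simp [Pi.single_eq_of_ne hx]) (by simp)]
    simp
  rw [← hout]
  have hOP := outputLaw_mem_stdSimplex hP hV
  have hOP' := outputLaw_mem_stdSimplex hP' hV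
  have hac : ∀ b, outputLaw P' V b = 0 → outputLaw P V b = 0 := fun b hb => by
    rw [hout] at hb
    have h1 := mul_nonneg hr0.le ((hV a).1 b)
    have h2 := mul_nonneg hr1'.le (hOP.1 b)
    have h3 : (1 - r) * outputLaw P V b = 0 := by linarith
    exact (mul_eq_zero.1 h3).resolve_left hr1'.ne'
  have hgold := sum_mul_relEntropy_eq hP hV hOP'.1 hac
  have hnn := relEntropy_nonneg hOP hOP' hac
  have hle := hmax P' hP'
  have hmix : mutualInfo P' V
      = (1 - r) * ∑ a', P a' * relEntropy (V a') (outputLaw P' V)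
        + r * relEntropy (V a) (outputLaw P' V) := by
    rw [mutualInfo_eq_sum_mul_relEntropy]
    generalize outputLaw P' V = q
    simp only [hP'def, Pi.add_apply, Pi.smul_apply, smul_eq_mul, add_mul,
      Finset.sum_add_distrib, mul_assoc, ← Finset.mul_sum]
    congr 2
    rw [Finset.sum_eq_single a (fun x _ hx => by simp [Pi.single_eq_of_ne hx]) (by simp)]
    simp
  have h1 : (1 - r) * capacity V
      ≤ (1 - r) * ∑ a', P a' * relEntropy (V a') (outputLaw P' V) :=
    mul_le_mul_of_nonneg_left (by linarith) hr1'.le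
  have h2 : r * relEntropy (V a) (outputLaw P' V) ≤ r * capacity V := by linarith
  exact le_of_mul_le_mul_left h2 hr0

/-- The capacity-achieving output law dominates every row of the channel, and every row is within
relative entropy `capacity V` of it. -/
theorem exists_relEntropy_le_capacity [Nonempty A] {V : A → B → ℝ} (hV : IsChannel V) :
    ∃ Q ∈ stdSimplex ℝ B, (∀ a b, Q b = 0 → V a b = 0) ∧
      ∀ a, relEntropy (V a) Q ≤ capacity V := by
  classical
  obtain ⟨P, hP, hPC, hmax⟩ := exists_mutualInfo_eq_capacity hV
  have hQ := outputLaw_mem_stdSimplex hP hV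
  set Q := outputLaw P V with hQdef
  have hmix := fun a r => relEntropy_mix_le_capacity hV hP hPC hmax a (r := r)
  -- If Q b = 0 < V a b, the mixture has mass at most r at b, so its relative entropy from V a grows
  -- at least like -V a b log r, contradicting the bound by C as r → 0.
  have hac : ∀ a b, Q b = 0 → V a b = 0 := by
    intro a b hb
    by_contra hne
    have hVab : 0 < V a b := ((hV a).1 b).lt_of_ne (Ne.symm hne)
    have hterm : ∀ r, 0 < r → r < 1 →
        -V a b * Real.log r ≤ capacity V + ∑ b', Real.negMulLog (V a b') := by
      intro r hr0 hr1
      have h := hmix a r hr0 hr1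
      rw [relEntropy] at h
      have hlow : ∀ b', (if b' = b then -V a b * Real.log r else 0) - Real.negMulLog (V a b')
          ≤ V a b' * Real.log (V a b' / ((1 - r) * Q b' + r * V a b')) := by
        intro b'
        rcases ((hV a).1 b').eq_or_lt with h0 | h0
        · have : b' ≠ b := fun h => hne (h ▸ h0.symm)
          rw [← h0]
          simp [this]
        · have hq0 : 0 < (1 - r) * Q b' + r * V a b' := by
            have := mul_nonneg (sub_pos.2 hr1).le (hQ.1 b')
            positivity
          rw [Real.log_div h0.ne' hq0.ne', Real.negMulLog]
          split_ifs with hbb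
          · subst hbb
            have h1 : Real.log ((1 - r) * Q b' + r * V a b') ≤ Real.log r := by
              refine Real.log_le_log hq0 ?_
              rw [hb, mul_zero, zero_add]
              exact mul_le_of_le_one_right hr0.le (mem_Icc_of_mem_stdSimplex (hV a) b').2
            nlinarith [mul_le_mul_of_nonneg_left h1 h0.le]
          · have h1 : Real.log ((1 - r) * Q b' + r * V a b') ≤ 0 := by
              refine Real.log_nonpos hq0.le ?_
              have hq1 := (mem_Icc_of_mem_stdSimplex hQ b').2
              have hv1 := (mem_Icc_of_mem_stdSimplex (hV a) b').2
              nlinarith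
            nlinarith [mul_le_mul_of_nonneg_left h1 h0.le]
      have hs := Finset.sum_le_sum fun b' (_ : b' ∈ Finset.univ) => hlow b'
      rw [Finset.sum_sub_distrib, Finset.sum_ite_eq' Finset.univ b] at hs
      simp only [Finset.mem_univ, if_true] at hs
      linarith
    have htend : Tendsto (fun r => -V a b * Real.log r) (𝓝[>] 0) atTop :=
      Real.tendsto_log_nhdsGT_zero.const_mul_atBot_of_neg (neg_lt_zero.2 hVab)
    obtain ⟨r, ⟨hr, hr0⟩, hr1⟩ := ((htend.eventually_gt_atTop _).and
      (self_mem_nhdsWithin)).and (mem_nhdsWithin_of_mem_nhds (Iio_mem_nhds one_pos)) |>.exists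
    exact absurd (hterm r hr0 hr1) (not_le.2 hr)
  refine ⟨Q, hQ, hac, fun a => ?_⟩
  -- Let r → 0 in the mixture bound; domination keeps the logarithms continuous at r = 0.
  have hlim : Tendsto (fun r : ℝ => relEntropy (V a) (fun b => (1 - r) * Q b + r * V a b))
      (𝓝[>] 0) (𝓝 (relEntropy (V a) Q)) := by
    refine tendsto_finsetSum _ fun b _ => ?_
    rcases ((hV a).1 b).eq_or_lt with h0 | h0
    · simp [← h0]
    · have hQb : Q b ≠ 0 := fun h => h0.ne' (hac a b h)
      have hc : ContinuousAt (fun r : ℝ => V a b * Real.log (V a b / ((1 - r) * Q b + r * V a b)))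
          0 := by
        have h1 : (1 - (0 : ℝ)) * Q b + 0 * V a b ≠ 0 := by simpa using hQb
        have h2 : V a b / ((1 - (0 : ℝ)) * Q b + 0 * V a b) ≠ 0 := div_ne_zero h0.ne' h1
        exact continuousAt_const.mul
          (ContinuousAt.log (continuousAt_const.div (by fun_prop) h1) h2)
      have := hc.tendsto.mono_left (nhdsWithin_le_nhds (s := Set.Ioi 0))
      simpa using this
  refine le_of_tendsto hlim ?_
  filter_upwards [self_mem_nhdsWithin, mem_nhdsWithin_of_mem_nhds (Iio_mem_nhds one_pos)]
    with r hr0 hr1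
  exact hmix a r hr0 hr1

end Capacity

/-! ### Chernoff bound and strong converse -/

section StrongConverse

variable {A B : Type*} [Fintype B]

/-- The exponentially tilted mass `𝔼[exp (θ (log (p/q) - c))]` under `p`. -/
noncomputable def tiltedMass (p q : B → ℝ) (c θ : ℝ) : ℝ :=
  ∑ b, p b * Real.exp (θ * (Real.log (p b / q b) - c))

theorem tiltedMass_nonneg {p : B → ℝ} (hp : ∀ b, 0 ≤ p b) (q : B → ℝ) (c θ : ℝ) :
    0 ≤ tiltedMass p q c θ :=
  Finset.sum_nonneg fun b _ => mul_nonneg (hp b) (Real.exp_pos _).le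

/-- At θ = 0 the tilted mass equals 1 and has derivative D(p ‖ q) - c < 0. -/
theorem eventually_tiltedMass_lt_one {p q : B → ℝ} (hp : p ∈ stdSimplex ℝ B) {c : ℝ}
    (hc : relEntropy p q < c) : ∀ᶠ θ in 𝓝[>] 0, tiltedMass p q c θ < 1 := by
  have hd : HasDerivAt (tiltedMass p q c) (relEntropy p q - c) 0 := by
    have h : HasDerivAt (tiltedMass p q c)
        (∑ b, p b * (Real.exp (0 * (Real.log (p b / q b) - c))
          * (1 * (Real.log (p b / q b) - c)))) 0 :=
      HasDerivAt.fun_sum fun b _ =>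
        (((hasDerivAt_id (0 : ℝ)).mul_const _).exp.const_mul (p b))
    convert h using 1
    simp only [zero_mul, Real.exp_zero, one_mul]
    simp only [mul_sub, Finset.sum_sub_distrib, ← Finset.sum_mul, hp.2, one_mul]
    rfl
  have h0 : tiltedMass p q c 0 = 1 := by simp [tiltedMass, hp.2]
  filter_upwards [(hd.tendsto_slope_zero_right).eventually_lt_const (sub_neg.2 hc),
    self_mem_nhdsWithin] with θ hθ hθ0
  rw [zero_add, h0, smul_eq_mul] at hθ
  exact sub_neg.1 (neg_of_mul_neg_right hθ (inv_nonneg.2 (le_of_lt hθ0)))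

theorem memoryless_isChannel {V : A → B → ℝ} (hV : IsChannel V) (n : ℕ) :
    IsChannel (memoryless V n) := by
  classical
  refine fun x => ⟨fun y => Finset.prod_nonneg fun i _ => (hV _).1 _, ?_⟩
  have h := Fintype.prod_sum fun (i : Fin n) b => V (x i) b
  simp only [(hV _).2, Finset.prod_const_one] at h
  exact h.symm

theorem prod_mem_stdSimplex {Q : B → ℝ} (hQ : Q ∈ stdSimplex ℝ B) (n : ℕ) :
    (fun y : Fin n → B => ∏ i, Q (y i)) ∈ stdSimplex ℝ (Fin n → B) :=
  memoryless_isChannel (A := Unit) (V := fun _ => Q) (fun _ => hQ) n fun _ => ()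

/-- Chernoff bound for the information density of a memoryless channel. -/
theorem one_sub_prod_tiltedMass_le_probInfoLe {V : A → B → ℝ} (hV : IsChannel V) {Q : B → ℝ}
    (hQ : Q ∈ stdSimplex ℝ B) (hac : ∀ a b, Q b = 0 → V a b = 0) {n : ℕ} (x : Fin n → A)
    {c θ s : ℝ} (hθ : 0 < θ) (hs : n * c ≤ s) :
    1 - ∏ i, tiltedMass (V (x i)) Q c θ
      ≤ probInfoLe (memoryless V n) (fun y => ∏ i, Q (y i)) x s := by
  classical
  -- The product of tilted masses expands into a sum over output words, so the bound can be checked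
  -- word by word: where the density exceeds s ≥ n c, the exponent is nonnegative.
  have h1 := Fintype.prod_sum fun (i : Fin n) b =>
    V (x i) b * Real.exp (θ * (Real.log (V (x i) b / Q b) - c))
  have hprod : ∏ i, tiltedMass (V (x i)) Q c θ = _ := h1
  rw [hprod, ← (memoryless_isChannel hV n x).2, ← Finset.sum_sub_distrib]
  refine Finset.sum_le_sum fun y _ => ?_
  have hQn : 0 ≤ ∏ i, Q (y i) := Finset.prod_nonneg fun i _ => hQ.1 _
  have hnn : 0 ≤ ∏ i, (V (x i) (y i) * Real.exp (θ * (Real.log (V (x i) (y i) / Q (y i)) - c))) :=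
    Finset.prod_nonneg fun i _ => mul_nonneg ((hV _).1 _) (Real.exp_pos _).le
  split_ifs with h
  · linarith
  · rw [mul_zero, sub_nonpos, Finset.prod_mul_distrib, ← Real.exp_sum]
    rw [infoDensity_le_coe_iff (Q := fun y : Fin n → B => ∏ i, Q (y i)) hQn, not_le] at h
    have hW : 0 < memoryless V n x y := (mul_nonneg (Real.exp_pos s).le hQn).trans_lt h
    have hVpos : ∀ i, 0 < V (x i) (y i) := fun i =>
      ((hV _).1 _).lt_of_ne fun h0 =>
        hW.ne' (Finset.prod_eq_zero (Finset.mem_univ i) h0.symm)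
    have hQpos : ∀ i, 0 < Q (y i) := fun i =>
      (hQ.1 _).lt_of_ne fun h0 => (hVpos i).ne' (hac _ _ h0.symm)
    refine le_mul_of_one_le_right hW.le (Real.one_le_exp ?_)
    rw [← Finset.mul_sum, Finset.sum_sub_distrib, Finset.sum_const, Finset.card_univ,
      Fintype.card_fin, nsmul_eq_mul]
    have hlog := Real.log_le_log
      (mul_pos (Real.exp_pos s) (Finset.prod_pos fun i _ => hQpos i)) h.le
    rw [Real.log_mul (Real.exp_pos s).ne' (Finset.prod_pos fun i _ => hQpos i).ne', Real.log_exp,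
      memoryless, Real.log_prod fun i _ => (hVpos i).ne',
      Real.log_prod fun i _ => (hQpos i).ne'] at hlog
    have hsum : ∑ i, Real.log (V (x i) (y i) / Q (y i))
        = ∑ i, Real.log (V (x i) (y i)) - ∑ i, Real.log (Q (y i)) := by
      rw [← Finset.sum_sub_distrib]
      exact Finset.sum_congr rfl fun i _ => Real.log_div (hVpos i).ne' (hQpos i).ne'
    rw [hsum]
    exact mul_nonneg hθ.le (by linarith)

/-- The input alphabet is finite, so one θ serves all letters and ρ is the largest tilted mass. -/
theorem exists_geometric_le_probInfoLe [Fintype A] [Nonempty A] {V : A → B → ℝ} (hV : IsChannel V) {c : ℝ}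
    (hc : capacity V < c) :
    ∃ Q ∈ stdSimplex ℝ B, ∃ ρ : ℝ, 0 ≤ ρ ∧ ρ < 1 ∧ ∀ (n : ℕ) (s : ℝ), n * c ≤ s →
      ∀ x, 1 - ρ ^ n ≤ probInfoLe (memoryless V n) (fun y => ∏ i, Q (y i)) x s := by
  obtain ⟨Q, hQ, hac, hcap⟩ := exists_relEntropy_le_capacity hV
  have hev : ∀ᶠ θ in 𝓝[>] (0 : ℝ), ∀ a, tiltedMass (V a) Q c θ < 1 :=
    eventually_all.2 fun a => eventually_tiltedMass_lt_one (hV a) ((hcap a).trans_lt hc)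
  obtain ⟨θ, hθ, hθ0⟩ := (hev.and self_mem_nhdsWithin).exists
  obtain ⟨a₀, ha₀⟩ := Finite.exists_max fun a => tiltedMass (V a) Q c θ
  refine ⟨Q, hQ, tiltedMass (V a₀) Q c θ, tiltedMass_nonneg (hV a₀).1 Q c θ, hθ a₀,
    fun n s hs x => ?_⟩
  refine le_trans (sub_le_sub_left ?_ 1)
    (one_sub_prod_tiltedMass_le_probInfoLe hV hQ hac x hθ0 hs)
  calc ∏ i, tiltedMass (V (x i)) Q c θ ≤ ∏ _i : Fin n, tiltedMass (V a₀) Q c θ :=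
        Finset.prod_le_prod (fun i _ => tiltedMass_nonneg (hV _).1 Q c θ) fun i _ => ha₀ _
    _ = tiltedMass (V a₀) Q c θ ^ n := by simp

theorem capacity_nonneg [Fintype A] [Nonempty A] {V : A → B → ℝ} (hV : IsChannel V) : 0 ≤ capacity V := by
  obtain ⟨Q, hQ, hac, hcap⟩ := exists_relEntropy_le_capacity hV
  obtain ⟨a⟩ := ‹Nonempty A›
  exact (relEntropy_nonneg (hV a) hQ (hac a)).trans (hcap a)

/-- Rounding costs at most a factor 2, since e^r < ⌊e^r⌋ + 1 ≤ 2⌊e^r⌋. -/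
theorem sub_log_two_le_log {r : ℝ} (hr : 0 ≤ r) {M : ℕ} (hM : ⌊Real.exp r⌋₊ ≤ M) :
    r - Real.log 2 ≤ Real.log M := by
  have h1 : 1 ≤ Real.exp r := Real.one_le_exp hr
  have h2 : (1 : ℝ) ≤ ⌊Real.exp r⌋₊ := by exact_mod_cast Nat.floor_pos.2 h1
  have h3 : Real.exp r < ⌊Real.exp r⌋₊ + 1 := Nat.lt_floor_add_one _
  have h4 : (⌊Real.exp r⌋₊ : ℝ) ≤ M := by exact_mod_cast hM
  have h5 : Real.exp r / 2 ≤ M := by linarith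
  rw [← Real.log_exp r, ← Real.log_div (Real.exp_pos r).ne' two_ne_zero]
  exact Real.log_le_log (by positivity) h5

theorem exists_tendsto_one_le_improvedBound [Fintype A] [Nonempty A] {V : A → B → ℝ} (hV : IsChannel V)
    {R : ℝ} (hR : capacity V < R) {M : ℕ → ℕ}
    (hM : ∀ᶠ n : ℕ in atTop, ⌊Real.exp (n * R)⌋₊ ≤ M n) :
    ∃ u : ℕ → ℝ, Tendsto u atTop (𝓝 1) ∧
      ∀ᶠ n in atTop, ((u n : ℝ) : EReal) ≤ improvedBound (memoryless V n) (M n) := by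
  -- The gap R - C is split in three: one share lifts c above C, one pays for γ = nδ, and one
  -- absorbs the log 2 lost to rounding.
  obtain ⟨δ, hδ⟩ : ∃ δ, δ = (R - capacity V) / 3 := ⟨_, rfl⟩
  have hδ0 : 0 < δ := by linarith
  have hR0 : 0 ≤ R := (capacity_nonneg hV).trans hR.le
  obtain ⟨Q, hQ, ρ, hρ0, hρ1, hb⟩ :=
    exists_geometric_le_probInfoLe hV (c := capacity V + δ) (by linarith)
  have hnδ : Tendsto (fun n : ℕ => (n : ℝ) * δ) atTop atTop :=
    tendsto_natCast_atTop_atTop.atTop_mul_const hδ0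
  refine ⟨fun n => 1 - ρ ^ n - Real.exp (-(n * δ)), ?_, ?_⟩
  · have h1 := tendsto_pow_atTop_nhds_zero_of_lt_one hρ0 hρ1
    have h2 := Real.tendsto_exp_neg_atTop_nhds_zero.comp hnδ
    have h3 := (h1.const_sub 1).sub h2
    rw [sub_zero, sub_zero] at h3
    exact h3
  · filter_upwards [hM, hnδ.eventually_ge_atTop (Real.log 2)] with n hMn hn
    refine le_trans (EReal.coe_le_coe_iff.2 (sub_le_sub_right (le_ciInf fun x => ?_) _))
      (iInf_probInfoLe_le_improvedBound (memoryless V n) (M n) (n * δ) (prod_mem_stdSimplex hQ n))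
    refine hb n _ ?_ x
    have h1 := sub_log_two_le_log (by positivity) hMn
    have h2 : (n : ℝ) * R = n * (capacity V + δ) + 2 * (n * δ) := by
      rw [hδ]
      ring
    linarith

end StrongConverse

end JSCC

theorem mainTheorem4 :
    -- the converse for an arbitrary finite channel and `M` equiprobable messages
    (∀ (X Y : Type*) [Fintype X] [Nonempty X] [Fintype Y] (W : X → Y → ℝ) (M : ℕ),
      JSCC.IsChannel W → 1 ≤ M →
        (∀ (E : Fin M → X → ℝ) (D : Y → Fin M → ℝ), JSCC.IsChannel E → JSCC.IsChannel D →
          JSCC.optSC (JSCC.errorLoss M X Y) (JSCC.uniformSource M) W ≤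
            ((JSCC.expectedLoss (JSCC.errorLoss M X Y) (JSCC.uniformSource M) W E D : ℝ)
              : EReal)) ∧
        (∀ (f : Fin M → X) (g : Y → Fin M),
          JSCC.optSC (JSCC.errorLoss M X Y) (JSCC.uniformSource M) W ≤
            ((JSCC.detError W f g : ℝ) : EReal)) ∧
        JSCC.optDP (JSCC.errorLoss M X Y) (JSCC.uniformSource M) W ≤
          JSCC.optSC (JSCC.errorLoss M X Y) (JSCC.uniformSource M) W ∧
        JSCC.improvedBound W M ≤
          JSCC.optDP (JSCC.errorLoss M X Y) (JSCC.uniformSource M) W ∧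
        JSCC.wolfowitzBound W M ≤ JSCC.improvedBound W M) ∧
    -- the strong converse for stationary memoryless channels
    (∀ (A B : Type*) [Fintype A] [Nonempty A] [Fintype B] (V : A → B → ℝ) (R : ℝ) (M : ℕ → ℕ),
      JSCC.IsChannel V → JSCC.capacity V < R →
      (∀ᶠ n : ℕ in atTop, ⌊Real.exp (n * R)⌋₊ ≤ M n) →
        Tendsto (fun n => JSCC.improvedBound (JSCC.memoryless V n) (M n)) atTop (𝓝 1) ∧
        Tendsto (fun n => JSCC.optDP (JSCC.errorLoss (M n) (Fin n → A) (Fin n → B))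
          (JSCC.uniformSource (M n)) (JSCC.memoryless V n)) atTop (𝓝 1) ∧
        Tendsto (fun n => JSCC.optSC (JSCC.errorLoss (M n) (Fin n → A) (Fin n → B))
          (JSCC.uniformSource (M n)) (JSCC.memoryless V n)) atTop (𝓝 1)) := by
  refine ⟨fun X Y _ _ _ W M hW hM => ⟨fun E D hE hD => JSCC.optSC_le_expectedLoss hE hD,
    JSCC.optSC_le_detError W, JSCC.optDP_le_optSC _ _ _, JSCC.improvedBound_le_optDP W hM,
    JSCC.wolfowitzBound_le_improvedBound W M⟩, fun A B _ _ _ V R M hV hR hM => ?_⟩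
  obtain ⟨u, hu, hle⟩ := JSCC.exists_tendsto_one_le_improvedBound hV hR hM
  have hu' : Tendsto (fun n => ((u n : ℝ) : EReal)) atTop (𝓝 1) :=
    (continuous_coe_real_ereal.tendsto 1).comp hu
  have hR0 : 0 ≤ R := (JSCC.capacity_nonneg hV).trans hR.le
  have hM1 : ∀ᶠ n in atTop, 1 ≤ M n := hM.mono fun n hn =>
    (Nat.floor_pos.2 (Real.one_le_exp (by positivity))).trans_le hn
  have hBD : ∀ᶠ n in atTop, JSCC.improvedBound (JSCC.memoryless V n) (M n)
      ≤ JSCC.optDP (JSCC.errorLoss (M n) (Fin n → A) (Fin n → B))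
        (JSCC.uniformSource (M n)) (JSCC.memoryless V n) :=
    hM1.mono fun n hn => JSCC.improvedBound_le_optDP _ hn
  have hDS := fun n => JSCC.optDP_le_optSC (JSCC.errorLoss (M n) (Fin n → A) (Fin n → B))
    (JSCC.uniformSource (M n)) (JSCC.memoryless V n)
  have hS : ∀ᶠ n in atTop, JSCC.optSC (JSCC.errorLoss (M n) (Fin n → A) (Fin n → B))
      (JSCC.uniformSource (M n)) (JSCC.memoryless V n) ≤ 1 :=
    hM1.mono fun n hn => JSCC.optSC_le_one (JSCC.memoryless_isChannel hV n) hn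
  -- All three limits are squeezed by u ≤ B ≤ OPT(DP) ≤ OPT(SC) ≤ 1, valid for large n.
  refine ⟨tendsto_of_tendsto_of_tendsto_of_le_of_le' hu' tendsto_const_nhds hle ?_,
    tendsto_of_tendsto_of_tendsto_of_le_of_le' hu' tendsto_const_nhds ?_ ?_,
    tendsto_of_tendsto_of_tendsto_of_le_of_le' hu' tendsto_const_nhds ?_ hS⟩
  · filter_upwards [hBD, hS] with n h1 h2 using (h1.trans (hDS n)).trans h2
  · filter_upwards [hle, hBD] with n h1 h2 using h1.trans h2
  · filter_upwards [hS] with n h using (hDS n).trans h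
  · filter_upwards [hle, hBD] with n h1 h2 using (h1.trans h2).trans (hDS n)
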